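/- Let $F$ be the space of finite non-empty subsets of $\mathbb{C}$ with the Vietoris topology (the topology of the Hausdorff metric), which has as a basis the sets $$U_{\{O_i\}_{i\in I},N}=\{A\in F : A\cap O_i\neq\emptyset \text{ for all } i\in I,\ \text{and } A\subseteq N\},$$ where $\{O_i\}_{i\in I}$ is a finite family of open subsets of $\mathbb{C}$ and $N\subseteq\mathbb{C}$ is open. Consider the full topological model over $F$, that is, the Heyting-valued model of set theory over the Heyting algebra of open subsets of $F$; write $U\Vdash\varphi$ if the open set $U$ is contained in the truth value of $\varphi$. In this model, complex numbers are pairs of Dedekind reals, and an open set $N\subseteq\mathbb{C}$ of the ground model is interpreted as the union of the open rational rectangles contained in $N$. Let $H$ be the canonical generic subset of $\mathbb{C}$ in this model, that is, the largest subset of $\mathbb{C}$ such that $U_{\{O_i\}_{i\in I},N}\Vdash H\subseteq N$ for all such $\{O_i\}_{i\in I}$ and $N$; in other words, $H$ consists of the complex numbers of the model that belong to $N$ for every $U_{\{O_i\}_{i\in I},N}$ in the generic filter. Then $$F\Vdash\text{``}H\text{ does not contain any points''},$$ that is, the truth value of $\neg\exists X\,(X\in H)$ is all of $F$. -/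

import Mathlib

open TopologicalSpace
open scoped symmDiff

noncomputable section

/-! ### The Heyting-valued universe over a frame `Ω` -/

/-- Names (terms) for sets in the full Heyting-valued model over `Ω`: a name is a family of names
`elt i`, each one put into the set with truth value `val i`. -/
inductive HName (Ω : Type) : Type 1
  | mk (ι : Type) (elt : ι → HName Ω) (val : ι → Ω) : HName Ω

namespace HName

variable {Ω : Type} [Order.Frame Ω]

/-- The truth value `⟦x = y⟧`: every member of `x` is a member of `y`, and conversely. -/
def eq : HName Ω → HName Ω → Ω
  | mk ι A v, mk κ B w =>
    (⨅ i : ι, v i ⇨ ⨆ j : κ, w j ⊓ eq (A i) (B j)) ⊓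
      (⨅ j : κ, w j ⇨ ⨆ i : ι, v i ⊓ eq (A i) (B j))

/-- The truth value `⟦x ∈ y⟧`. -/
def mem (x : HName Ω) : HName Ω → Ω
  | mk ι A v => ⨆ i : ι, v i ⊓ eq x (A i)

/-- The canonical name of a ground-model set: `x̌ = {⟨⊤, y̌⟩ | y ∈ x}`. -/
def check : PSet.{0} → HName Ω
  | PSet.mk ι A => mk ι (fun i => check (A i)) (fun _ => ⊤)

/-- The unordered pair `{x, y}` in the model. -/
def upair (x y : HName Ω) : HName Ω :=
  mk Bool (fun b => if b then x else y) (fun _ => ⊤)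

/-- The (Kuratowski) ordered pair `(x, y) = {{x, x}, {x, y}}` in the model. -/
def opair (x y : HName Ω) : HName Ω :=
  upair (upair x x) (upair x y)

/-! ### Rationals, Dedekind reals and complex numbers in the model

A rational number is coded by a von Neumann natural number, so `ℚ̌` is the canonical name of a
ground-model set. A quantifier over `ℚ̌` is the supremum or infimum over all `q : ℚ`, and the
decidable relation `q < r` on `ℚ̌` is evaluated in the ground model. -/

/-- The name `q̌` of the rational number `q`. -/
def rat (q : ℚ) : HName Ω := check (PSet.ofNat (Encodable.encode q))

/-- The name of a subset of `ℚ̌`, where `q̌` is put into the set with truth value `f q`. -/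
def ratSubset (f : ℚ → Ω) : HName Ω := mk ℚ rat f

/-- The truth value of "the subsets `L`, `R` of `ℚ̌` are the lower and the upper cut of a Dedekind
real": both are inhabited and rounded, and they are disjoint and located. -/
def isDedekind (L R : HName Ω) : Ω :=
  (⨆ q : ℚ, mem (rat q) L) ⊓ (⨆ q : ℚ, mem (rat q) R) ⊓
  (⨅ q : ℚ, mem (rat q) L ⇔ ⨆ (r : ℚ) (_ : q < r), mem (rat r) L) ⊓
  (⨅ q : ℚ, mem (rat q) R ⇔ ⨆ (r : ℚ) (_ : r < q), mem (rat r) R) ⊓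
  (⨅ q : ℚ, (mem (rat q) L ⊓ mem (rat q) R)ᶜ) ⊓
  (⨅ (q : ℚ) (r : ℚ) (_ : q < r), mem (rat q) L ⊔ mem (rat r) R)

end HName

/-- Two pairs of `Ω`-valued subsets of `ℚ`: the candidates for the lower and upper cuts of the real
and imaginary parts of a complex number in the model. -/
structure ComplexCode (Ω : Type) where
  reL : ℚ → Ω
  reR : ℚ → Ω
  imL : ℚ → Ω
  imR : ℚ → Ω

namespace ComplexCode

open HName

variable {Ω : Type} [Order.Frame Ω]

/-- The name of `((L₁, R₁), (L₂, R₂))`, a pair of pairs of subsets of `ℚ̌`. -/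
def name (z : ComplexCode Ω) : HName Ω :=
  opair (opair (ratSubset z.reL) (ratSubset z.reR)) (opair (ratSubset z.imL) (ratSubset z.imR))

/-- The truth value of "`z` is a complex number", that is, a pair of Dedekind reals. -/
def isComplex (z : ComplexCode Ω) : Ω :=
  isDedekind (ratSubset z.reL) (ratSubset z.reR) ⊓ isDedekind (ratSubset z.imL) (ratSubset z.imR)

/-- The truth value of "the complex number `z` belongs to `N`", where the ground-model open set
`N ⊆ ℂ` is interpreted in the model as the union of the open rational rectangles
`(a, b) × (c, d)` which the ground model sees to be contained in `N`. -/
def inOpen (N : Opens ℂ) (z : ComplexCode Ω) : Ω :=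
  ⨆ (a : ℚ) (b : ℚ) (c : ℚ) (d : ℚ) (_ : a < b) (_ : c < d)
    (_ : Set.Ioo (a : ℝ) b ×ℂ Set.Ioo (c : ℝ) d ⊆ (N : Set ℂ)),
    mem (rat a) (ratSubset z.reL) ⊓ mem (rat b) (ratSubset z.reR) ⊓
      (mem (rat c) (ratSubset z.imL) ⊓ mem (rat d) (ratSubset z.imR))

end ComplexCode

/-! ### The space of finite non-empty sets of complex numbers -/

/-- The finite, non-empty subsets of `ℂ`. -/
def FinSets : Type := {A : Set ℂ // A.Finite ∧ A.Nonempty}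

namespace FinSets

/-- The Vietoris topology. -/
instance : TopologicalSpace FinSets :=
  TopologicalSpace.induced Subtype.val (TopologicalSpace.vietoris ℂ)

/-- The basic open set given by finitely many positive pieces of information `O ∈ P` and one
negative piece of information `N`: it consists of all `A` that meet every `O ∈ P` and satisfy
`A ⊆ N`. -/
def basicOpen (P : Finset (Opens ℂ)) (N : Opens ℂ) : Opens FinSets where
  carrier := {A | (∀ O ∈ P, (A.1 ∩ (O : Set ℂ)).Nonempty) ∧ A.1 ⊆ (N : Set ℂ)}
  is_open' := by
    let _ := TopologicalSpace.vietoris ℂ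
    have hc : Continuous (Subtype.val : FinSets → Set ℂ) := continuous_induced_dom
    have h1 : IsOpen {A : Set ℂ | ∀ O ∈ P, (A ∩ (O : Set ℂ)).Nonempty} := by
      have : {A : Set ℂ | ∀ O ∈ P, (A ∩ (O : Set ℂ)).Nonempty} =
          ⋂ O ∈ P, {A : Set ℂ | (A ∩ (O : Set ℂ)).Nonempty} := by
        ext A; simp
      rw [this]
      exact isOpen_biInter_finset fun O _ => vietoris.isOpen_inter_nonempty_of_isOpen O.isOpen
    exact (h1.inter N.isOpen.powerset_vietoris).preimage hc

/-- `U ⊩ φ`, for a statement `φ` with truth value `p` in the topological model over `FinSets`. -/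
def Forces (U p : Opens FinSets) : Prop := U ≤ p

open ComplexCode

/-- The canonical generic `H ⊆ ℂ`: the set of all complex numbers `z` of the model which belong to
the negative information `N` of every basic open set `U` in the generic filter; the truth value of
"`U` is in the generic filter" is `U` itself. Thus `H` is the largest subset of `ℂ` in the model
such that `U ⊩ H ⊆ N` for every basic open `U` with negative information `N`. -/
def genericH : HName (Opens FinSets) :=
  HName.mk (ComplexCode (Opens FinSets)) name fun z =>
    isComplex z ⊓ ⨅ (P : Finset (Opens ℂ)) (N : Opens ℂ), basicOpen P N ⇨ inOpen N z

end FinSets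

end

/-!
Let `z` be a complex number of the model over `F`. Over the open set `V` of points forcing `z ∈ H`,
the Dedekind cuts of `z` trace out a continuous function `f : V → ℂ`, and applying the definition
of `H` to the complement of the point `f A` shows that `f A ∈ A`: a member of `H` is a continuous
selection on `V`. No such selection exists near any `A`: split `a = f A` into the two points
`a + w` and `a - w`. For small `w`, continuity forces `f` to pick one of the two, and as `w` runs
over a small circle, connectedness forces always the same choice of sign. But `w` and `-w` give the
same set, so the selected point would be both `a + w` and `a - w`.
-/

/-- Two-sided Dedekind cuts in `ℚ`, presented as a pair of a lower and an upper set; the fields are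
the conjuncts of `HName.isDedekind`, read in the ground model. -/
structure IsDedekindCut (L R : Set ℚ) : Prop where
  left_nonempty : L.Nonempty
  right_nonempty : R.Nonempty
  mem_left_iff_exists : ∀ q, q ∈ L ↔ ∃ r, q < r ∧ r ∈ L
  mem_right_iff_exists : ∀ q, q ∈ R ↔ ∃ r, r < q ∧ r ∈ R
  disjoint : Disjoint L R
  located : ∀ q r, q < r → q ∈ L ∨ r ∈ R

/-- The real number with lower cut `L`, as a supremum in `ℝ`; the junk value is `0` if `L` is empty
or unbounded above. -/
noncomputable def cutReal (L : Set ℚ) : ℝ := sSup ((↑) '' L)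

namespace IsDedekindCut

variable {L R : Set ℚ} {q r : ℚ}

theorem lt (h : IsDedekindCut L R) (hq : q ∈ L) (hr : r ∈ R) : q < r := by
  by_contra! hrq
  have hrL : r ∈ L := by
    rcases hrq.eq_or_lt with rfl | hrq
    · exact hq
    · exact (h.mem_left_iff_exists r).2 ⟨q, hrq, hq⟩
  exact h.disjoint.notMem_of_mem_left hrL hr

theorem cast_mem_upperBounds (h : IsDedekindCut L R) (hr : r ∈ R) :
    (r : ℝ) ∈ upperBounds ((↑) '' L) := by
  rintro _ ⟨q, hq, rfl⟩
  exact_mod_cast (h.lt hq hr).le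

theorem mem_left_iff (h : IsDedekindCut L R) : q ∈ L ↔ (q : ℝ) < cutReal L := by
  obtain ⟨r, hr⟩ := h.right_nonempty
  rw [cutReal, lt_csSup_iff ⟨_, h.cast_mem_upperBounds hr⟩ (h.left_nonempty.image _),
    Set.exists_mem_image, h.mem_left_iff_exists q]
  simp only [Rat.cast_lt, and_comm]

theorem mem_right_iff (h : IsDedekindCut L R) : q ∈ R ↔ cutReal L < q := by
  constructor
  · intro hq
    obtain ⟨r, hrq, hr⟩ := (h.mem_right_iff_exists q).1 hq
    calc cutReal L ≤ r := csSup_le (h.left_nonempty.image _) (h.cast_mem_upperBounds hr)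
      _ < q := by exact_mod_cast hrq
  · intro hq
    obtain ⟨s, hs, hsq⟩ := exists_rat_btwn hq
    exact (h.located s q (by exact_mod_cast hsq)).resolve_left fun hsL =>
      hs.not_gt (h.mem_left_iff.1 hsL)

end IsDedekindCut

section Opens

variable {X : Type*} [TopologicalSpace X] {U V : Opens X} {x : X}

theorem mem_of_mem_himp (h : x ∈ U ⇨ V) (hx : x ∈ U) : x ∈ V :=
  himp_inf_le (a := U) (b := V) ⟨h, hx⟩

theorem mem_iff_of_mem_bihimp (h : x ∈ U ⇔ V) : x ∈ U ↔ x ∈ V :=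
  ⟨mem_of_mem_himp h.2, mem_of_mem_himp h.1⟩

theorem mem_of_mem_iInf {ι : Sort*} {W : ι → Opens X} (h : x ∈ ⨅ i, W i) (i : ι) : x ∈ W i :=
  iInf_le W i h

theorem notMem_of_mem_compl (h : x ∈ Uᶜ) : x ∉ U := fun hx =>
  (disjoint_compl_right (a := U)).le_bot ⟨hx, h⟩

end Opens

namespace HName

open Topology

variable {X : Type} [TopologicalSpace X] {L R : HName (Opens X)} {x : X}

/-- The fibre at the point `x` of a subset of `ℚ̌` in the topological model over `X`. -/
def ratsAt (L : HName (Opens X)) (x : X) : Set ℚ := {q | x ∈ mem (rat q) L}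

theorem mem_ratsAt {q : ℚ} : q ∈ ratsAt L x ↔ x ∈ mem (rat q) L := Iff.rfl

/-- The fibre at the point `x` of the Dedekind real with lower cut `L`. -/
noncomputable def realAt (L : HName (Opens X)) (x : X) : ℝ := cutReal (ratsAt L x)

theorem isOpen_setOfPred_mem_ratsAt (L : HName (Opens X)) (q : ℚ) : IsOpen {x | q ∈ ratsAt L x} :=
  (mem (rat q) L).isOpen

theorem isDedekindCut_ratsAt (h : x ∈ isDedekind L R) :
    IsDedekindCut (ratsAt L x) (ratsAt R x) := by
  obtain ⟨⟨⟨⟨⟨hL, hR⟩, hLo⟩, hRo⟩, hdisj⟩, hloc⟩ := h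
  exact {
    left_nonempty := Opens.mem_iSup.1 hL
    right_nonempty := Opens.mem_iSup.1 hR
    mem_left_iff_exists q := by
      simpa only [mem_ratsAt, Opens.mem_iSup, exists_prop] using
        mem_iff_of_mem_bihimp (mem_of_mem_iInf hLo q)
    mem_right_iff_exists q := by
      simpa only [mem_ratsAt, Opens.mem_iSup, exists_prop] using
        mem_iff_of_mem_bihimp (mem_of_mem_iInf hRo q)
    disjoint := Set.disjoint_left.2 fun q hqL hqR =>
      notMem_of_mem_compl (mem_of_mem_iInf hdisj q) ⟨hqL, hqR⟩
    located q r hqr := mem_of_mem_iInf (mem_of_mem_iInf (mem_of_mem_iInf hloc q) r) hqr }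

theorem mem_ratsAt_left_iff (h : x ∈ isDedekind L R) {q : ℚ} :
    q ∈ ratsAt L x ↔ (q : ℝ) < realAt L x :=
  (isDedekindCut_ratsAt h).mem_left_iff

theorem mem_ratsAt_right_iff (h : x ∈ isDedekind L R) {q : ℚ} :
    q ∈ ratsAt R x ↔ realAt L x < q :=
  (isDedekindCut_ratsAt h).mem_right_iff

theorem continuousOn_realAt : ContinuousOn (realAt L) (isDedekind L R : Opens X) := by
  refine fun x hx => ContinuousAt.continuousWithinAt ?_
  have hcut : ∀ᶠ y in 𝓝 x, y ∈ isDedekind L R := (isDedekind L R).isOpen.mem_nhds hx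
  refine tendsto_order.2 ⟨fun a ha => ?_, fun a ha => ?_⟩
  · obtain ⟨q, haq, hq⟩ := exists_rat_btwn ha
    have hqL := (isOpen_setOfPred_mem_ratsAt L q).mem_nhds ((mem_ratsAt_left_iff hx).2 hq)
    filter_upwards [hcut, hqL] with y hy hyq
    exact haq.trans ((mem_ratsAt_left_iff hy).1 hyq)
  · obtain ⟨q, hq, hqa⟩ := exists_rat_btwn ha
    have hqR := (isOpen_setOfPred_mem_ratsAt R q).mem_nhds ((mem_ratsAt_right_iff hx).2 hq)
    filter_upwards [hcut, hqR] with y hy hyq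
    exact ((mem_ratsAt_right_iff hy).1 hyq).trans hqa

end HName

namespace ComplexCode

open HName

variable {X : Type} [TopologicalSpace X]

/-- The fibre at the point `x` of a complex number of the topological model over `X`. -/
noncomputable def valueAt (z : ComplexCode (Opens X)) (x : X) : ℂ :=
  ⟨realAt (ratSubset z.reL) x, realAt (ratSubset z.imL) x⟩

theorem continuousOn_valueAt (z : ComplexCode (Opens X)) : ContinuousOn z.valueAt z.isComplex := by
  have hre : ContinuousOn (realAt (ratSubset z.reL)) z.isComplex :=
    continuousOn_realAt.mono fun _ hx => hx.1
  have him : ContinuousOn (realAt (ratSubset z.imL)) z.isComplex :=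
    continuousOn_realAt.mono fun _ hx => hx.2
  exact Complex.equivRealProdCLM.symm.continuous.comp_continuousOn (hre.prodMk him)

theorem valueAt_mem_of_mem_inOpen {z : ComplexCode (Opens X)} {N : Opens ℂ} {x : X}
    (hz : x ∈ z.isComplex) (hN : x ∈ z.inOpen N) : z.valueAt x ∈ N := by
  simp only [inOpen, Opens.mem_iSup] at hN
  obtain ⟨a, b, c, d, -, -, hsub, ⟨ha, hb⟩, hc, hd⟩ := hN
  obtain ⟨hre, him⟩ := hz
  exact hsub ⟨⟨(mem_ratsAt_left_iff hre).1 ha, (mem_ratsAt_right_iff hre).1 hb⟩,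
    (mem_ratsAt_left_iff him).1 hc, (mem_ratsAt_right_iff him).1 hd⟩

end ComplexCode

theorem map_neg_of_continuousOn_of_eq_or_eq_neg {𝕜 : Type*} [Field 𝕜] [TopologicalSpace 𝕜]
    [T1Space 𝕜] [ContinuousMul 𝕜] [ContinuousInv₀ 𝕜] {S : Set 𝕜} (hS : IsPreconnected S)
    (h0 : 0 ∉ S) {g : 𝕜 → 𝕜} (hg : ContinuousOn g S) (hsign : ∀ w ∈ S, g w = w ∨ g w = -w)
    {w : 𝕜} (hw : w ∈ S) (hw' : -w ∈ S) : g (-w) = -g w := by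
  have hsq : S.EqOn (g ^ 2) (id ^ 2) := fun v hv => sq_eq_sq_iff_eq_or_eq_neg.2 (hsign v hv)
  rcases hS.eq_or_eq_neg_of_sq_eq hg continuousOn_id hsq (ne_of_mem_of_not_mem · h0) with h | h
  · rw [h hw, h hw', id, id]
  · rw [h hw, h hw', Pi.neg_apply, Pi.neg_apply, id, id]

theorem not_even_of_continuousOn_sphere {r : ℝ} (hr : 0 < r) {g : ℂ → ℂ}
    (hg : ContinuousOn g (Metric.sphere 0 r))
    (hsign : ∀ w ∈ Metric.sphere 0 r, g w = w ∨ g w = -w) : ¬ g.Even := by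
  intro heven
  have hconn : IsPreconnected (Metric.sphere (0 : ℂ) r) :=
    isPreconnected_sphere (by simp [Complex.rank_real_complex]) 0 r
  have h0 : (0 : ℂ) ∉ Metric.sphere 0 r := fun h => Metric.ne_of_mem_sphere h hr.ne' rfl
  obtain ⟨w, hw⟩ : (Metric.sphere (0 : ℂ) r).Nonempty := NormedSpace.sphere_nonempty.2 hr.le
  have hodd : g (-w) = -g w :=
    map_neg_of_continuousOn_of_eq_or_eq_neg hconn h0 hg hsign hw (by simpa using hw)
  have hgw : g w = 0 := self_eq_neg.1 ((heven w).symm.trans hodd)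
  have hw0 : w = 0 := by simpa [hgw, eq_comm] using hsign w hw
  exact h0 (hw0 ▸ hw)

namespace FinSets

open Filter Topology

/-- The set `A` with the point `a` replaced by the two points `a + w` and `a - w`. -/
def split (A : FinSets) (a w : ℂ) : FinSets :=
  ⟨A.1 \ {a} ∪ ({a + w} ∪ {a - w}), A.2.1.sdiff.union (Set.toFinite _), a + w, by simp⟩

theorem mem_split_iff {A : FinSets} {a w x : ℂ} :
    x ∈ (split A a w).1 ↔ x ∈ A.1 \ {a} ∨ x = a + w ∨ x = a - w :=
  Iff.rfl

theorem split_zero {A : FinSets} {a : ℂ} (ha : a ∈ A.1) : split A a 0 = A :=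
  Subtype.ext (by simpa [split] using Set.insert_eq_of_mem ha)

theorem split_neg (A : FinSets) (a w : ℂ) : split A a (-w) = split A a w :=
  Subtype.ext (by simp only [split, sub_neg_eq_add, ← sub_eq_add_neg, Set.union_comm {a - w}])

theorem continuous_split (A : FinSets) (a : ℂ) : Continuous (split A a) := by
  let _ := TopologicalSpace.vietoris ℂ
  have hadd : Continuous fun w => ({a + w} : Set ℂ) :=
    vietoris.continuous_singleton.comp (continuous_const.add continuous_id)
  have hsub : Continuous fun w => ({a - w} : Set ℂ) :=
    vietoris.continuous_singleton.comp (continuous_const.sub continuous_id)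
  exact continuous_induced_rng.2 <| vietoris.continuous_union.comp <|
    continuous_const.prodMk (vietoris.continuous_union.comp (hadd.prodMk hsub))

theorem eventually_selection_split {f : FinSets → ℂ} {A : FinSets} (hf : ContinuousAt f A)
    (hsel : ∀ᶠ B in 𝓝 A, f B ∈ B.1) :
    ∀ᶠ w in 𝓝 0, f (split A (f A) w) = f A + w ∨ f (split A (f A) w) = f A - w := by
  have hsplit : Tendsto (split A (f A)) (𝓝 0) (𝓝 A) := by
    simpa only [split_zero hsel.self_of_nhds] using (continuous_split A (f A)).tendsto 0
  have hnear : ∀ᶠ B in 𝓝 A, f B ∈ (A.1 \ {f A})ᶜ :=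
    hf.eventually_mem (A.2.1.sdiff.isClosed.compl_mem_nhds fun h => h.2 rfl)
  filter_upwards [hsplit.eventually hsel, hsplit.eventually hnear] with w hw hw'
  exact (mem_split_iff.1 hw).resolve_left hw'

theorem not_continuousOn_of_forall_mem {V : Set FinSets} (hV : IsOpen V) (hne : V.Nonempty)
    {f : FinSets → ℂ} (hsel : ∀ B ∈ V, f B ∈ B.1) : ¬ ContinuousOn f V := by
  intro hf
  obtain ⟨A, hA⟩ := hne
  have hVA : V ∈ 𝓝 A := hV.mem_nhds hA
  have hsplitV : ∀ᶠ w in 𝓝 0, split A (f A) w ∈ V :=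
    (continuous_split A (f A)).continuousAt.eventually_mem ((split_zero (hsel A hA)).symm ▸ hVA)
  have hsign := eventually_selection_split (hf.continuousAt hVA) (eventually_of_mem hVA hsel)
  obtain ⟨r, hr, hball⟩ := Metric.nhds_basis_closedBall.eventually_iff.1 (hsplitV.and hsign)
  have hsphere : ∀ w ∈ Metric.sphere (0 : ℂ) r, w ∈ Metric.closedBall 0 r :=
    Metric.sphere_subset_closedBall
  let g : ℂ → ℂ := fun w => f (split A (f A) w) - f A
  have hg : ContinuousOn g (Metric.sphere 0 r) :=
    (hf.comp (continuous_split A (f A)).continuousOn fun w hw => (hball (hsphere w hw)).1).sub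
      continuousOn_const
  have hgsign : ∀ w ∈ Metric.sphere 0 r, g w = w ∨ g w = -w := fun w hw =>
    (hball (hsphere w hw)).2.imp (by simp [g, ·]) (by simp [g, ·])
  exact not_even_of_continuousOn_sphere hr hg hgsign fun w => by simp only [g, split_neg]

open ComplexCode

/-- The truth value of "`z` is a complex number which lies in the negative information of every
basic open set in the generic filter", with which `z` is put into the name `genericH`. -/
noncomputable def inGeneric (z : ComplexCode (Opens FinSets)) : Opens FinSets :=
  z.isComplex ⊓ ⨅ (P : Finset (Opens ℂ)) (N : Opens ℂ), basicOpen P N ⇨ z.inOpen N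

theorem mem_genericH (X : HName (Opens FinSets)) :
    HName.mem X genericH = ⨆ z, inGeneric z ⊓ HName.eq X (name z) :=
  rfl

theorem valueAt_mem_of_mem_inGeneric {z : ComplexCode (Opens FinSets)} {A : FinSets}
    (hA : A ∈ inGeneric z) : z.valueAt A ∈ A.1 := by
  obtain ⟨hz, hneg⟩ := hA
  by_contra hzA
  let N : Opens ℂ := ⟨{z.valueAt A}ᶜ, isOpen_compl_singleton⟩
  have hAN : A ∈ basicOpen ∅ N := ⟨by simp, Set.subset_compl_singleton_iff.2 hzA⟩
  have hzN : A ∈ z.inOpen N :=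
    mem_of_mem_himp (mem_of_mem_iInf (mem_of_mem_iInf hneg ∅) N) hAN
  exact valueAt_mem_of_mem_inOpen hz hzN rfl

theorem inGeneric_eq_bot (z : ComplexCode (Opens FinSets)) : inGeneric z = ⊥ := by
  by_contra hne
  refine not_continuousOn_of_forall_mem (inGeneric z).isOpen ?_
    (fun _ => valueAt_mem_of_mem_inGeneric) (z.continuousOn_valueAt.mono fun _ hA => hA.1)
  exact (Opens.ne_bot_iff_nonempty _).1 hne

end FinSets

theorem theorem8 :
    FinSets.Forces ⊤ (⨆ X : HName (Opens FinSets), HName.mem X FinSets.genericH)ᶜ := by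
  have hempty (X : HName (Opens FinSets)) : HName.mem X FinSets.genericH = ⊥ := by
    simp only [FinSets.mem_genericH, FinSets.inGeneric_eq_bot, bot_inf_eq, iSup_bot]
  simp only [FinSets.Forces, hempty, iSup_bot, compl_bot, le_refl]
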